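/- Let $\Omega\subset\mathbb R^2$ be a bounded domain with polygonal Lipschitz boundary $\Gamma$, each of whose (finitely many, open) edges is either clamped, simply supported or free; let $\Gamma_c,\Gamma_s,\Gamma_f$ be the corresponding parts of $\Gamma$, and assume that $\Gamma_c$ contains at least one edge (edges are maximal: two edges with the same boundary condition do not meet at an angle of $\pi$). Let $n$ be the unit outer normal and let $\mathcal C$ be a material tensor, i.e. a linear map on symmetric $2\times2$ matrices that is symmetric and positive definite for the Frobenius inner product $A:B=\sum_{i,j}A_{ij}B_{ij}$. Put $$Q=H^1_{0,\Gamma_c\cup\Gamma_s}(\Omega)=\{v\in H^1(\Omega): v=0\text{ on }\Gamma_c\cup\Gamma_s\},\qquad \|v\|_Q=\|v\|_{H^1(\Omega)},$$ $$W=\{v\in H^2(\Omega): v=0,\ \partial v/\partial n=0\text{ on }\Gamma_c,\quad v=0\text{ on }\Gamma_s\}\subset Q,$$ and let $Q^*$ be the dual of $Q$. Let $\operatorname{div}\operatorname{Div}$ be the adjoint of $\nabla^2$, viewed as a densely defined operator from $Q$ to $L^2(\Omega)_{\rm sym}$ with domain $W$: its domain is $$V=\Big\{N\in L^2(\Omega)_{\rm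 sym}:\ \text{there is } G\in Q^*\text{ with } \int_\Omega\nabla^2v:N\,dx=\langle G,v\rangle\text{ for all }v\in W\Big\},$$ and $\operatorname{div}\operatorname{Div}N=G$ for $N\in V$. Let $F\in Q^*$. The primal problem is: find $w\in W$ such that $$\int_\Omega\mathcal C\nabla^2w:\nabla^2v\,dx=\langle F,v\rangle\quad\text{for all }v\in W.$$ The mixed problem is: find $M\in V$ and $w\in Q$ such that $$\int_\Omega\mathcal C^{-1}M:N\,dx+\langle\operatorname{div}\operatorname{Div}N,w\rangle=0\quad\text{for all }N\in V,$$ $$\langle\operatorname{div}\operatorname{Div}M,v\rangle=-\langle F,v\rangle\quad\text{for all }v\in Q.$$ Then the two problems are equivalent in the following sense. If $w$ solves the primal problem, then $M=-\mathcal C\nabla^2w\in V$ and $(M,w)$ solves the mixed problem. Conversely, if $(M,w)$ solves the mixed problem, then $w\in W$ and $w$ solves the primal problem. -/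

import Mathlib

open MeasureTheory Filter Topology Set
open scoped ContDiff ENNReal

noncomputable section

namespace KirchhoffPlate

/-! ### Points, symmetric matrices and Lebesgue spaces -/

/-- The Euclidean plane. -/
abbrev E2 : Type := EuclideanSpace ℝ (Fin 2)

/-- Symmetric real `2 × 2` matrices; the inherited inner product is the Frobenius inner product
`A : B = ∑ i j, A i j * B i j`. -/
def symSubmodule : Submodule ℝ (EuclideanSpace ℝ (Fin 2 × Fin 2)) where
  carrier := {A | ∀ i j, A (i, j) = A (j, i)}
  add_mem' := by
    intro A B hA hB i j
    simp [hA i j, hB i j]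
  zero_mem' := by
    intro i j
    simp
  smul_mem' := by
    intro c A hA i j
    simp [hA i j]

abbrev SymMat : Type := symSubmodule

/-- The entry `A i j` of a symmetric matrix. -/
def SymMat.entry (A : SymMat) (i j : Fin 2) : ℝ := (A : EuclideanSpace ℝ (Fin 2 × Fin 2)) (i, j)

/-- `L²(Ω; X)`. In particular `L2 Ω SymMat` is the space of symmetric matrix-valued functions
with square integrable entries. -/
abbrev L2 (Ω : Set E2) (X : Type) [NormedAddCommGroup X] : Type :=
  Lp X 2 (volume.restrict Ω)

/-! ### Weak derivatives and the Sobolev spaces `H¹(Ω)`, `H²(Ω)` -/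

/-- The classical partial derivative `∂ᵢ φ`. -/
def partialD (i : Fin 2) (φ : E2 → ℝ) (x : E2) : ℝ :=
  fderiv ℝ φ x (EuclideanSpace.single i 1)

/-- Test functions: elements of `C₀^∞(Ω)`. -/
def IsTestFunction (Ω : Set E2) (φ : E2 → ℝ) : Prop :=
  ContDiff ℝ ∞ φ ∧ HasCompactSupport φ ∧ tsupport φ ⊆ Ω

/-- `g` is the weak partial derivative `∂ᵢ u` in `Ω`
(only used for `u`, `g` square integrable over `Ω`). -/
def IsWeakPartial (Ω : Set E2) (i : Fin 2) (u g : E2 → ℝ) : Prop :=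
  ∀ φ : E2 → ℝ, IsTestFunction Ω φ →
    ∫ x in Ω, u x * partialD i φ x = - ∫ x in Ω, g x * φ x

lemma IsTestFunction.partialD {Ω : Set E2} {φ : E2 → ℝ} (h : IsTestFunction Ω φ) (i : Fin 2) :
    IsTestFunction Ω (partialD i φ) := by
  obtain ⟨h1, h2, h3⟩ := h
  have hsub : tsupport (KirchhoffPlate.partialD i φ) ⊆ tsupport φ := by
    refine closure_minimal ?_ (isClosed_tsupport φ)
    intro x hx
    by_contra hne
    apply hx
    have : fderiv ℝ φ x = 0 := by
      by_contra h0
      exact hne (support_fderiv_subset ℝ (Function.mem_support.mpr h0))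
    simp [KirchhoffPlate.partialD, this]
  refine ⟨?_, ?_, hsub.trans h3⟩
  · exact (h1.fderiv_right (m := ∞) (by simp)).clm_apply contDiff_const
  · exact h2.of_isClosed_subset (isClosed_tsupport _) hsub

lemma integrable_mul_test {Ω : Set E2} {u φ : E2 → ℝ} (hu : MemLp u 2 (volume.restrict Ω))
    (hφ : IsTestFunction Ω φ) : IntegrableOn (fun x => u x * φ x) Ω := by
  have h2 : MemLp φ 2 (volume.restrict Ω) :=
    (hφ.1.continuous.memLp_of_hasCompactSupport hφ.2.1).restrict _
  exact hu.integrable_mul h2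

lemma IsWeakPartial.congr {Ω : Set E2} {i : Fin 2} {u g u' g' : E2 → ℝ}
    (h : IsWeakPartial Ω i u g) (hu : u =ᵐ[volume.restrict Ω] u')
    (hg : g =ᵐ[volume.restrict Ω] g') : IsWeakPartial Ω i u' g' := by
  intro φ hφ
  have e1 : ∫ x in Ω, u x * KirchhoffPlate.partialD i φ x =
      ∫ x in Ω, u' x * KirchhoffPlate.partialD i φ x :=
    integral_congr_ae (hu.mul (EventuallyEq.refl _ (KirchhoffPlate.partialD i φ)))
  have e2 : ∫ x in Ω, g x * φ x = ∫ x in Ω, g' x * φ x :=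
    integral_congr_ae (hg.mul (EventuallyEq.refl _ φ))
  rw [← e1, ← e2]
  exact h φ hφ

lemma IsWeakPartial.add {Ω : Set E2} {i : Fin 2} {u g u' g' : E2 → ℝ}
    (h : IsWeakPartial Ω i u g) (h' : IsWeakPartial Ω i u' g')
    (hu : MemLp u 2 (volume.restrict Ω)) (hg : MemLp g 2 (volume.restrict Ω))
    (hu' : MemLp u' 2 (volume.restrict Ω)) (hg' : MemLp g' 2 (volume.restrict Ω)) :
    IsWeakPartial Ω i (fun x => u x + u' x) (fun x => g x + g' x) := by
  intro φ hφ
  simp only [add_mul]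
  rw [integral_add (integrable_mul_test hu (hφ.partialD i))
    (integrable_mul_test hu' (hφ.partialD i)),
    integral_add (integrable_mul_test hg hφ) (integrable_mul_test hg' hφ), h φ hφ, h' φ hφ]
  ring

lemma IsWeakPartial.smul {Ω : Set E2} {i : Fin 2} {u g : E2 → ℝ}
    (h : IsWeakPartial Ω i u g) (c : ℝ) :
    IsWeakPartial Ω i (fun x => c * u x) (fun x => c * g x) := by
  intro φ hφ
  simp only [mul_assoc]
  rw [integral_const_mul, integral_const_mul, h φ hφ]
  ring

lemma ae_eq_of_forall_test {Ω : Set E2} (hΩ : IsOpen Ω) {g g' : E2 → ℝ}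
    (hg : MemLp g 2 (volume.restrict Ω)) (hg' : MemLp g' 2 (volume.restrict Ω))
    (h : ∀ φ, IsTestFunction Ω φ → ∫ x in Ω, g x * φ x = ∫ x in Ω, g' x * φ x) :
    g =ᵐ[volume.restrict Ω] g' := by
  have hd : MemLp (fun x => g x - g' x) 2 (volume.restrict Ω) := hg.sub hg'
  have hloc : LocallyIntegrableOn (fun x => g x - g' x) Ω := by
    intro x hx
    obtain ⟨r, hr, hball⟩ := Metric.isOpen_iff.mp hΩ x hx
    refine ⟨Metric.ball x r, mem_nhdsWithin_of_mem_nhds (Metric.ball_mem_nhds x hr), ?_⟩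
    have h1 : MemLp (fun x => g x - g' x) 2 (volume.restrict (Metric.ball x r)) :=
      hd.mono_measure (Measure.restrict_mono hball le_rfl)
    have : IsFiniteMeasure (volume.restrict (Metric.ball x r) : Measure E2) :=
      ⟨by simpa using measure_ball_lt_top (μ := (volume : Measure E2)) (x := x) (r := r)⟩
    exact h1.integrable (by norm_num)
  have key := hΩ.ae_eq_zero_of_integral_contDiff_smul_eq_zero (μ := volume) hloc (by
    intro φ h1 h2 h3
    have hφ : IsTestFunction Ω φ := ⟨h1, h2, h3⟩
    have e1 : ∫ x, φ x • (g x - g' x) = ∫ x in Ω, φ x • (g x - g' x) := by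
      refine (setIntegral_eq_integral_of_forall_compl_eq_zero ?_).symm
      intro x hx
      rw [image_eq_zero_of_notMem_tsupport (fun hh => hx (h3 hh)), zero_smul]
    rw [e1]
    have e2 : (fun x => φ x • (g x - g' x)) = fun x => g x * φ x - g' x * φ x := by
      funext x
      simp only [smul_eq_mul]
      ring
    rw [e2, integral_sub (integrable_mul_test hg hφ) (integrable_mul_test hg' hφ), h φ hφ,
      sub_self])
  rw [EventuallyEq, ae_restrict_iff' hΩ.measurableSet]
  filter_upwards [key] with x hx hxΩ
  exact sub_eq_zero.mp (hx hxΩ)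

lemma IsWeakPartial.unique {Ω : Set E2} (hΩ : IsOpen Ω) {i : Fin 2} {u g g' : E2 → ℝ}
    (h : IsWeakPartial Ω i u g) (h' : IsWeakPartial Ω i u g')
    (hg : MemLp g 2 (volume.restrict Ω)) (hg' : MemLp g' 2 (volume.restrict Ω)) :
    g =ᵐ[volume.restrict Ω] g' := by
  refine ae_eq_of_forall_test hΩ hg hg' fun φ hφ => ?_
  have h1 := h φ hφ
  have h2 := h' φ hφ
  linarith

/-- Mixed weak second derivatives commute. -/
lemma IsWeakPartial.comm {Ω : Set E2} (hΩ : IsOpen Ω) {i j : Fin 2} {u p q a b : E2 → ℝ}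
    (hp : IsWeakPartial Ω i u p) (hq : IsWeakPartial Ω j u q)
    (ha : IsWeakPartial Ω j p a) (hb : IsWeakPartial Ω i q b)
    (ha2 : MemLp a 2 (volume.restrict Ω)) (hb2 : MemLp b 2 (volume.restrict Ω)) :
    a =ᵐ[volume.restrict Ω] b := by
  refine ae_eq_of_forall_test hΩ ha2 hb2 fun φ hφ => ?_
  have e1 := ha φ hφ
  have e2 := hb φ hφ
  have e3 := hp _ (hφ.partialD j)
  have e4 := hq _ (hφ.partialD i)
  have hc : ∀ x, partialD i (partialD j φ) x = partialD j (partialD i φ) x := by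
    intro x
    have hsymm : IsSymmSndFDerivAt ℝ φ x :=
      hφ.1.contDiffAt.isSymmSndFDerivAt (by
        rw [minSmoothness_of_isRCLikeNormedField]
        exact WithTop.coe_le_coe.mpr le_top)
    have hd : DifferentiableAt ℝ (fderiv ℝ φ) x :=
      ((hφ.1.fderiv_right (m := ∞) (by simp)).differentiable (by simp)) x
    have hform : ∀ k l : Fin 2, partialD k (partialD l φ) x =
        fderiv ℝ (fderiv ℝ φ) x (EuclideanSpace.single k 1) (EuclideanSpace.single l 1) := by
      intro k l
      have hfun : partialD l φ = fun y => fderiv ℝ φ y (EuclideanSpace.single l 1) := rfl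
      rw [hfun, partialD, fderiv_clm_apply hd (differentiableAt_const _)]
      simp
    rw [hform, hform]
    exact hsymm _ _
  simp only [hc] at e3
  linarith

/-- The Sobolev space `H¹(Ω)`. Its elements are the pairs consisting of a function `u ∈ L²(Ω)` and
its (unique) weak gradient `∇u ∈ L²(Ω)²`, and the inherited norm is
`‖u‖₁ = (‖u‖₀² + ‖∇u‖₀²)^(1/2)`. -/
def H1 (Ω : Set E2) : Submodule ℝ (WithLp 2 (L2 Ω ℝ × L2 Ω E2)) where
  carrier := {v | ∀ i : Fin 2, IsWeakPartial Ω i v.fst (fun x => v.snd x i)}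
  add_mem' := by
    intro a b ha hb i
    have hm : ∀ c : WithLp 2 (L2 Ω ℝ × L2 Ω E2),
        MemLp (fun x => c.snd x i) 2 (volume.restrict Ω) := fun c =>
      (EuclideanSpace.proj (𝕜 := ℝ) i).comp_memLp' (Lp.memLp c.snd)
    refine ((ha i).add (hb i) (Lp.memLp _) (hm a) (Lp.memLp _) (hm b)).congr ?_ ?_
    · exact (Lp.coeFn_add a.fst b.fst).symm
    · filter_upwards [Lp.coeFn_add a.snd b.snd] with x hx
      rw [WithLp.add_snd, hx]
      rfl
  zero_mem' := by
    intro i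
    have h0 : IsWeakPartial Ω i (fun _ => 0) (fun _ => 0) := by
      intro φ _
      simp
    refine h0.congr ?_ ?_
    · exact (Lp.coeFn_zero ℝ 2 (volume.restrict Ω)).symm
    · filter_upwards [Lp.coeFn_zero E2 2 (volume.restrict Ω)] with x hx
      rw [WithLp.zero_snd, hx]
      rfl
  smul_mem' := by
    intro c a ha i
    refine ((ha i).smul c).congr ?_ ?_
    · exact (Lp.coeFn_smul c a.fst).symm
    · filter_upwards [Lp.coeFn_smul c a.snd] with x hx
      rw [WithLp.smul_snd, hx]
      rfl

/-- The function underlying an element of `H¹(Ω)`. -/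
def H1.val {Ω : Set E2} (v : H1 Ω) : L2 Ω ℝ := (v : WithLp 2 (L2 Ω ℝ × L2 Ω E2)).fst

/-- The weak gradient of an element of `H¹(Ω)`. -/
def H1.grad {Ω : Set E2} (v : H1 Ω) : L2 Ω E2 := (v : WithLp 2 (L2 Ω ℝ × L2 Ω E2)).snd

lemma H1.isWeakPartial {Ω : Set E2} (v : H1 Ω) (i : Fin 2) :
    IsWeakPartial Ω i (H1.val v) (fun x => H1.grad v x i) := v.2 i

lemma memLp_coord {Ω : Set E2} (p : L2 Ω E2) (i : Fin 2) :
    MemLp (fun x => p x i) 2 (volume.restrict Ω) :=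
  (EuclideanSpace.proj (𝕜 := ℝ) i).comp_memLp' (Lp.memLp p)

/-- The entry map as a continuous linear map. -/
def entryL (i j : Fin 2) : SymMat →L[ℝ] ℝ :=
  (EuclideanSpace.proj (𝕜 := ℝ) (i, j)).comp symSubmodule.subtypeL

lemma memLp_entry {Ω : Set E2} (H : L2 Ω SymMat) (i j : Fin 2) :
    MemLp (fun x => (H x).entry i j) 2 (volume.restrict Ω) :=
  (entryL i j).comp_memLp' (Lp.memLp H)

/-- `H²(Ω)`: the functions in `H¹(Ω)` all of whose second weak partial derivatives are in
`L²(Ω)`. -/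
def MemH2 {Ω : Set E2} (v : H1 Ω) : Prop :=
  ∀ i j : Fin 2, ∃ h : L2 Ω ℝ, IsWeakPartial Ω j (fun x => H1.grad v x i) h

/-- `H` is the weak Hessian of `v`, `H i j = ∂ⱼ ∂ᵢ v`. -/
def IsHessian {Ω : Set E2} (v : H1 Ω) (H : L2 Ω SymMat) : Prop :=
  ∀ i j : Fin 2, IsWeakPartial Ω j (fun x => H1.grad v x i) (fun x => (H x).entry i j)

lemma IsHessian.unique {Ω : Set E2} (hΩ : IsOpen Ω) {v : H1 Ω} {H H' : L2 Ω SymMat}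
    (h : IsHessian v H) (h' : IsHessian v H') : H = H' := by
  have he : ∀ i j : Fin 2, (fun x => (H x).entry i j) =ᵐ[volume.restrict Ω]
      fun x => (H' x).entry i j := fun i j =>
    (h i j).unique hΩ (h' i j) (memLp_entry H i j) (memLp_entry H' i j)
  refine Lp.ext ?_
  filter_upwards [he 0 0, he 0 1, he 1 0, he 1 1] with x h1 h2 h3 h4
  apply Subtype.ext
  ext ⟨i, j⟩
  fin_cases i <;> fin_cases j
  · exact h1
  · exact h2
  · exact h3
  · exact h4

/-- Every `H²` function has a (symmetric) Hessian in `L²`. -/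
lemma MemH2.exists_isHessian {Ω : Set E2} (hΩ : IsOpen Ω) {v : H1 Ω} (hv : MemH2 v) :
    ∃ H : L2 Ω SymMat, IsHessian v H := by
  choose h hh using hv
  let f : E2 → SymMat := fun x =>
    ⟨WithLp.toLp 2 (fun ij => if ij = ((1 : Fin 2), (0 : Fin 2)) then h 0 1 x
        else h ij.1 ij.2 x), by
      intro i j
      fin_cases i <;> fin_cases j <;> simp⟩
  have hf : MemLp f 2 (volume.restrict Ω) := by
    have hg : MemLp (fun x => (f x : EuclideanSpace ℝ (Fin 2 × Fin 2))) 2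
        (volume.restrict Ω) := by
      refine MemLp.of_eval_piLp ?_
      rintro ⟨i, j⟩
      by_cases hij : (i, j) = ((1 : Fin 2), (0 : Fin 2))
      · simpa [f, hij] using Lp.memLp (h 0 1)
      · simpa [f, hij] using Lp.memLp (h i j)
    have hproj := (symSubmodule.orthogonalProjectionOnto).comp_memLp' hg
    have he : (symSubmodule.orthogonalProjectionOnto ∘
        fun x => (f x : EuclideanSpace ℝ (Fin 2 × Fin 2))) = f := by
      funext x
      simp
    rwa [he] at hproj
  refine ⟨hf.toLp f, fun i j => (hh i j).congr (EventuallyEq.refl _ _) ?_⟩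
  have h10 : (h 1 0 : E2 → ℝ) =ᵐ[volume.restrict Ω] h 0 1 :=
    IsWeakPartial.comm hΩ (H1.isWeakPartial v 1) (H1.isWeakPartial v 0) (hh 1 0) (hh 0 1)
      (Lp.memLp _) (Lp.memLp _)
  filter_upwards [hf.coeFn_toLp, h10] with x hx hx'
  rw [hx]
  fin_cases i <;> fin_cases j <;> simp [f, SymMat.entry, hx']

open Classical in
/-- The Hessian `∇²v` of `v ∈ H²(Ω)`, an element of `L²(Ω)_sym`. -/
def hessian {Ω : Set E2} (v : H1 Ω) : L2 Ω SymMat :=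
  if h : ∃ H : L2 Ω SymMat, IsHessian v H then h.choose else 0

lemma MemH2.isHessian {Ω : Set E2} (hΩ : IsOpen Ω) {v : H1 Ω} (hv : MemH2 v) :
    IsHessian v (hessian v) := by
  have h := hv.exists_isHessian hΩ
  rw [hessian, dif_pos h]
  exact h.choose_spec

lemma IsHessian.hessian_eq {Ω : Set E2} (hΩ : IsOpen Ω) {v : H1 Ω} {H : L2 Ω SymMat}
    (h : IsHessian v H) : hessian v = H := by
  have h' : ∃ H : L2 Ω SymMat, IsHessian v H := ⟨H, h⟩
  rw [hessian, dif_pos h']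
  exact IsHessian.unique hΩ h'.choose_spec h

lemma IsHessian.memH2 {Ω : Set E2} {v : H1 Ω} {H : L2 Ω SymMat} (h : IsHessian v H) :
    MemH2 v := fun i j =>
  ⟨(memLp_entry H i j).toLp _,
    (h i j).congr (EventuallyEq.refl _ _) (memLp_entry H i j).coeFn_toLp.symm⟩

lemma IsHessian.add {Ω : Set E2} {v w : H1 Ω} {H K : L2 Ω SymMat}
    (hv : IsHessian v H) (hw : IsHessian w K) : IsHessian (v + w) (H + K) := by
  intro i j
  refine ((hv i j).add (hw i j) (memLp_coord _ i) (memLp_entry H i j) (memLp_coord _ i)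
    (memLp_entry K i j)).congr ?_ ?_
  · filter_upwards [Lp.coeFn_add (H1.grad v) (H1.grad w)] with x hx
    have : H1.grad (v + w) = H1.grad v + H1.grad w := rfl
    rw [this, hx]
    rfl
  · filter_upwards [Lp.coeFn_add H K] with x hx
    rw [hx]
    rfl

lemma IsHessian.smul {Ω : Set E2} {v : H1 Ω} {H : L2 Ω SymMat}
    (hv : IsHessian v H) (c : ℝ) : IsHessian (c • v) (c • H) := by
  intro i j
  refine ((hv i j).smul c).congr ?_ ?_
  · filter_upwards [Lp.coeFn_smul c (H1.grad v)] with x hx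
    have : H1.grad (c • v) = c • H1.grad v := rfl
    rw [this, hx]
    rfl
  · filter_upwards [Lp.coeFn_smul c H] with x hx
    rw [hx]
    rfl

/-! ### Boundary values -/

/-- The function `u`, which belongs to `H¹(Ω)` with weak gradient `p`, has the trace `g` on the
boundary part `S` of the bounded Lipschitz domain `Ω`: the trace operator is the continuous
extension of the restriction `φ ↦ φ|_S`, defined for smooth functions `φ` on the closure of `Ω`,
to an operator from `H¹(Ω)` to `L²(S)`. Here `S` carries the arc length measure. -/
def HasTrace (Ω S : Set E2) (u : E2 → ℝ) (p : E2 → E2) (g : E2 → ℝ) : Prop :=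
  ∃ φ : ℕ → E2 → ℝ,
    (∀ k, ContDiff ℝ ∞ (φ k) ∧ HasCompactSupport (φ k)) ∧
    Tendsto (fun k => eLpNorm (fun x => φ k x - u x) 2 (volume.restrict Ω)) atTop (𝓝 0) ∧
    (∀ i : Fin 2, Tendsto
      (fun k => eLpNorm (fun x => partialD i (φ k) x - p x i) 2 (volume.restrict Ω))
      atTop (𝓝 0)) ∧
    Tendsto (fun k => eLpNorm (fun x => φ k x - g x) 2 ((μH[1] : Measure E2).restrict S))
      atTop (𝓝 0)

lemma tendsto_eLpNorm_add {μ : Measure E2} {f g : ℕ → E2 → ℝ} {a b c : E2 → ℝ}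
    {F : ℕ → E2 → ℝ}
    (hfm : ∀ k, AEStronglyMeasurable (fun x => f k x - a x) μ)
    (hgm : ∀ k, AEStronglyMeasurable (fun x => g k x - b x) μ)
    (hf : Tendsto (fun k => eLpNorm (fun x => f k x - a x) 2 μ) atTop (𝓝 0))
    (hg : Tendsto (fun k => eLpNorm (fun x => g k x - b x) 2 μ) atTop (𝓝 0))
    (hF : ∀ k x, F k x = f k x + g k x) (hc : c =ᵐ[μ] fun x => a x + b x) :
    Tendsto (fun k => eLpNorm (fun x => F k x - c x) 2 μ) atTop (𝓝 0) := by
  have h0 := hf.add hg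
  rw [add_zero] at h0
  refine tendsto_of_tendsto_of_tendsto_of_le_of_le tendsto_const_nhds h0
    (fun _ => zero_le) fun k => ?_
  have : eLpNorm (fun x => F k x - c x) 2 μ =
      eLpNorm ((fun x => f k x - a x) + fun x => g k x - b x) 2 μ := by
    refine eLpNorm_congr_ae ?_
    filter_upwards [hc] with x hx
    simp only [hx, hF, Pi.add_apply]
    ring
  simp only [this]
  exact eLpNorm_add_le (hfm k) (hgm k) (by norm_num)

lemma tendsto_eLpNorm_smul {μ : Measure E2} {f F : ℕ → E2 → ℝ} {a b : E2 → ℝ} (c : ℝ)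
    (hf : Tendsto (fun k => eLpNorm (fun x => f k x - a x) 2 μ) atTop (𝓝 0))
    (hF : ∀ k x, F k x = c * f k x) (hb : b =ᵐ[μ] fun x => c * a x) :
    Tendsto (fun k => eLpNorm (fun x => F k x - b x) 2 μ) atTop (𝓝 0) := by
  have h0 := ENNReal.Tendsto.const_mul (a := ‖c‖ₑ) hf (Or.inr (by simp))
  rw [mul_zero] at h0
  refine h0.congr fun k => ?_
  rw [← eLpNorm_const_smul]
  refine eLpNorm_congr_ae ?_
  filter_upwards [hb] with x hx
  simp only [hx, hF, Pi.smul_apply, smul_eq_mul]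
  ring

lemma partialD_add {i : Fin 2} {φ ψ : E2 → ℝ} (hφ : ContDiff ℝ ∞ φ) (hψ : ContDiff ℝ ∞ ψ)
    (x : E2) : partialD i (fun y => φ y + ψ y) x = partialD i φ x + partialD i ψ x := by
  unfold partialD
  rw [fderiv_fun_add (hφ.differentiable (by simp) x) (hψ.differentiable (by simp) x)]
  rfl

lemma partialD_smul {i : Fin 2} {φ : E2 → ℝ} (hφ : ContDiff ℝ ∞ φ) (c : ℝ)
    (x : E2) : partialD i (fun y => c * φ y) x = c * partialD i φ x := by
  unfold partialD
  rw [fderiv_const_mul (hφ.differentiable (by simp) x)]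
  rfl

lemma continuous_partialD {i : Fin 2} {φ : E2 → ℝ} (hφ : ContDiff ℝ ∞ φ) :
    Continuous (partialD i φ) :=
  (hφ.continuous_fderiv (by simp)).clm_apply continuous_const

/-- Functions with zero trace on `S` are closed under addition. -/
lemma HasTrace.add_zero {Ω S : Set E2} {u u' u'' : E2 → ℝ} {p p' p'' : E2 → E2}
    (h : HasTrace Ω S u p 0) (h' : HasTrace Ω S u' p' 0)
    (hu : AEStronglyMeasurable u (volume.restrict Ω))
    (hp : ∀ i, AEStronglyMeasurable (fun x => p x i) (volume.restrict Ω))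
    (hu' : AEStronglyMeasurable u' (volume.restrict Ω))
    (hp' : ∀ i, AEStronglyMeasurable (fun x => p' x i) (volume.restrict Ω))
    (eu : u'' =ᵐ[volume.restrict Ω] fun x => u x + u' x)
    (ep : ∀ i, (fun x => p'' x i) =ᵐ[volume.restrict Ω] fun x => p x i + p' x i) :
    HasTrace Ω S u'' p'' 0 := by
  obtain ⟨φ, h1, h2, h3, h4⟩ := h
  obtain ⟨ψ, k1, k2, k3, k4⟩ := h'
  refine ⟨fun k x => φ k x + ψ k x, fun k => ⟨(h1 k).1.add (k1 k).1, (h1 k).2.add (k1 k).2⟩,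
    ?_, fun i => ?_, ?_⟩
  · exact tendsto_eLpNorm_add (fun k => (h1 k).1.continuous.aestronglyMeasurable.sub hu)
      (fun k => (k1 k).1.continuous.aestronglyMeasurable.sub hu') h2 k2 (fun _ _ => rfl) eu
  · exact tendsto_eLpNorm_add
      (fun k => (continuous_partialD (h1 k).1).aestronglyMeasurable.sub (hp i))
      (fun k => (continuous_partialD (k1 k).1).aestronglyMeasurable.sub (hp' i)) (h3 i) (k3 i)
      (fun k x => partialD_add (h1 k).1 (k1 k).1 x) (ep i)
  · refine tendsto_eLpNorm_add (a := 0) (b := 0)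
      (fun k => (h1 k).1.continuous.aestronglyMeasurable.sub aestronglyMeasurable_const)
      (fun k => (k1 k).1.continuous.aestronglyMeasurable.sub aestronglyMeasurable_const)
      h4 k4 (fun _ _ => rfl) ?_
    filter_upwards with x
    simp

/-- Functions with zero trace on `S` are closed under multiplication by constants. -/
lemma HasTrace.smul_zero {Ω S : Set E2} {u u' : E2 → ℝ} {p p' : E2 → E2}
    (h : HasTrace Ω S u p 0) (c : ℝ)
    (eu : u' =ᵐ[volume.restrict Ω] fun x => c * u x)
    (ep : ∀ i, (fun x => p' x i) =ᵐ[volume.restrict Ω] fun x => c * p x i) :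
    HasTrace Ω S u' p' 0 := by
  obtain ⟨φ, h1, h2, h3, h4⟩ := h
  refine ⟨fun k x => c * φ k x, fun k => ⟨contDiff_const.mul (h1 k).1, (h1 k).2.mul_left⟩,
    tendsto_eLpNorm_smul c h2 (fun _ _ => rfl) eu, fun i =>
    tendsto_eLpNorm_smul c (h3 i) (fun k x => partialD_smul (h1 k).1 c x) (ep i),
    tendsto_eLpNorm_smul (a := 0) c h4 (fun _ _ => rfl) ?_⟩
  filter_upwards with x
  simp

lemma HasTrace.zero {Ω S : Set E2} {u : E2 → ℝ} {p : E2 → E2}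
    (eu : u =ᵐ[volume.restrict Ω] fun _ => 0)
    (ep : ∀ i, (fun x => p x i) =ᵐ[volume.restrict Ω] fun _ => 0) :
    HasTrace Ω S u p 0 := by
  refine ⟨fun _ _ => 0, fun _ => ⟨contDiff_const, HasCompactSupport.zero⟩, ?_, fun i => ?_, ?_⟩
  · refine tendsto_const_nhds.congr fun k => ?_
    rw [← eLpNorm_zero (ε := ℝ) (p := 2) (μ := volume.restrict Ω)]
    refine eLpNorm_congr_ae ?_
    filter_upwards [eu] with x hx
    simp [hx]
  · refine tendsto_const_nhds.congr fun k => ?_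
    rw [← eLpNorm_zero (ε := ℝ) (p := 2) (μ := volume.restrict Ω)]
    refine eLpNorm_congr_ae ?_
    filter_upwards [ep i] with x hx
    simp [partialD, hx]
  · simp

/-- `Ω` is locally the set of points above the graph of a Lipschitz function. -/
def HasLipschitzBoundary (Ω : Set E2) : Prop :=
  ∀ x ∈ frontier Ω, ∃ r > 0, ∃ (e : E2 ≃ₗᵢ[ℝ] E2) (L : NNReal) (g : ℝ → ℝ),
    LipschitzWith L g ∧ ∀ y ∈ Metric.ball x r, y ∈ Ω ↔ g (e y 0) < e y 1

/-- The unit vector orthogonal to the segment from `a` to `b`, pointing to its right. -/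
def rightNormal (a b : E2) : E2 :=
  WithLp.toLp 2 ![(b 1 - a 1) / dist a b, -(b 0 - a 0) / dist a b]

/-- The three kinds of boundary conditions. -/
inductive EdgeKind
  | clamped
  | simplySupported
  | free

/-- A plate: a bounded domain with polygonal Lipschitz boundary, each of whose edges is either
clamped, simply supported or free, with at least one clamped edge. -/
structure Plate where
  /-- The mid-surface. -/
  Ω : Set E2
  isOpen : IsOpen Ω
  isConnected : IsConnected Ω
  isBounded : Bornology.IsBounded Ω
  lipschitz : HasLipschitzBoundary Ω
  /-- The number of edges. -/
  K : ℕ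
  /-- The end points of the edges. -/
  src : Fin K → E2
  tgt : Fin K → E2
  src_ne_tgt : ∀ k, src k ≠ tgt k
  frontier_eq : frontier Ω = ⋃ k, segment ℝ (src k) (tgt k)
  /-- Different edges meet at most in a common end point. -/
  disjoint : ∀ j k, j ≠ k → Disjoint (openSegment ℝ (src j) (tgt j)) (segment ℝ (src k) (tgt k))
  /-- The edges are oriented counterclockwise: `Ω` lies to the left of each edge. -/
  oriented : ∀ k, ∀ x ∈ openSegment ℝ (src k) (tgt k),
    ∀ᶠ s : ℝ in 𝓝[>] 0, x - s • rightNormal (src k) (tgt k) ∈ Ω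
  /-- The boundary condition prescribed on each edge. -/
  kind : Fin K → EdgeKind
  /-- Two edges with the same boundary condition do not meet at an angle of `π`. -/
  maximal : ∀ j k, j ≠ k → kind j = kind k → tgt j = src k →
    ¬ Collinear ℝ {src j, tgt j, tgt k}
  exists_clamped : ∃ k, kind k = EdgeKind.clamped

namespace Plate

variable (P : Plate)

/-- The `k`-th edge, an open line segment. -/
def edge (k : Fin P.K) : Set E2 := openSegment ℝ (P.src k) (P.tgt k)

/-- The unit outer normal vector on the `k`-th edge. -/
def normal (k : Fin P.K) : E2 := rightNormal (P.src k) (P.tgt k)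

/-- The part `Γ_c ∪ Γ_s` of the boundary (up to corner points). -/
def supported : Set E2 := ⋃ k ∈ {k | P.kind k ≠ EdgeKind.free}, P.edge k

/-- `Q = H¹_{0, Γ_c ∪ Γ_s}(Ω)`, with the norm of `H¹(Ω)`. -/
def Q : Submodule ℝ (H1 P.Ω) where
  carrier := {v | HasTrace P.Ω P.supported (H1.val v) (H1.grad v) 0}
  add_mem' := by
    intro a b ha hb
    refine ha.add_zero hb (Lp.aestronglyMeasurable _) (fun i => (memLp_coord _ i).1)
      (Lp.aestronglyMeasurable _) (fun i => (memLp_coord _ i).1)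
      (Lp.coeFn_add (H1.val a) (H1.val b)) fun i => ?_
    filter_upwards [Lp.coeFn_add (H1.grad a) (H1.grad b)] with x hx
    have : H1.grad (a + b) = H1.grad a + H1.grad b := rfl
    rw [this, hx]
    rfl
  zero_mem' := by
    refine HasTrace.zero (Lp.coeFn_zero ℝ 2 (volume.restrict P.Ω)) fun i => ?_
    filter_upwards [Lp.coeFn_zero E2 2 (volume.restrict P.Ω)] with x hx
    have : H1.grad (0 : H1 P.Ω) = 0 := rfl
    rw [this, hx]
    rfl
  smul_mem' := by
    intro c a ha
    refine HasTrace.smul_zero ha c (Lp.coeFn_smul c (H1.val a)) fun i => ?_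
    filter_upwards [Lp.coeFn_smul c (H1.grad a)] with x hx
    have : H1.grad (c • a) = c • H1.grad a := rfl
    rw [this, hx]
    rfl

/-- `n · ∇v`. -/
def normalD (n : E2) {Ω : Set E2} (v : H1 Ω) (x : E2) : ℝ := ∑ i, n i * H1.grad v x i

/-- The gradient `(∇²v) n` of `n · ∇v`, for a constant vector `n`. -/
def gradNormalD (n : E2) {Ω : Set E2} (v : H1 Ω) (x : E2) : E2 :=
  WithLp.toLp 2 fun j => ∑ i, n i * (hessian v x).entry i j

/-- `W = {v ∈ H²(Ω) : v = 0 on Γ_c ∪ Γ_s, ∂v/∂n = 0 on Γ_c}`. -/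
def W : Submodule ℝ (H1 P.Ω) where
  carrier := {v | MemH2 v ∧
    HasTrace P.Ω P.supported (H1.val v) (H1.grad v) 0 ∧
    ∀ k, P.kind k = EdgeKind.clamped →
      HasTrace P.Ω (P.edge k) (normalD (P.normal k) v) (gradNormalD (P.normal k) v) 0}
  add_mem' := by
    rintro a b ⟨ha, ha', ha''⟩ ⟨hb, hb', hb''⟩
    have hH := (ha.isHessian P.isOpen).add (hb.isHessian P.isOpen)
    have heq := hH.hessian_eq P.isOpen
    refine ⟨hH.memH2, P.Q.add_mem ha' hb', fun k hk => ?_⟩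
    have m1 : ∀ (n : E2) (v : H1 P.Ω),
        AEStronglyMeasurable (normalD n v) (volume.restrict P.Ω) := fun n v =>
      Finset.aestronglyMeasurable_fun_sum _ fun i _ => (memLp_coord _ i).1.const_mul _
    have m2 : ∀ (n : E2) (v : H1 P.Ω) (j : Fin 2),
        AEStronglyMeasurable (fun x => gradNormalD n v x j) (volume.restrict P.Ω) :=
      fun n v j => by
      simp only [gradNormalD]
      exact Finset.aestronglyMeasurable_fun_sum _ fun i _ =>
        (memLp_entry (hessian v) i j).1.const_mul _
    refine (ha'' k hk).add_zero (hb'' k hk) (m1 _ _) (m2 _ _) (m1 _ _) (m2 _ _) ?_ fun j => ?_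
    · filter_upwards [Lp.coeFn_add (H1.grad a) (H1.grad b)] with x hx
      have : H1.grad (a + b) = H1.grad a + H1.grad b := rfl
      simp only [normalD, this, hx, Pi.add_apply, PiLp.add_apply, mul_add,
        Finset.sum_add_distrib]
    · filter_upwards [Lp.coeFn_add (hessian a) (hessian b)] with x hx
      have he : ∀ (A B : SymMat) (i : Fin 2), (A + B).entry i j = A.entry i j + B.entry i j :=
        fun _ _ _ => rfl
      simp only [gradNormalD, heq, hx, Pi.add_apply, he, mul_add, Finset.sum_add_distrib]
  zero_mem' := by
    have hz : IsHessian (0 : H1 P.Ω) 0 := by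
      have h0 : ∀ i : Fin 2, IsWeakPartial P.Ω i (fun _ => 0) (fun _ => 0) := by
        intro i φ _
        simp
      intro i j
      refine (h0 j).congr ?_ ?_
      · filter_upwards [Lp.coeFn_zero E2 2 (volume.restrict P.Ω)] with x hx
        have : H1.grad (0 : H1 P.Ω) = 0 := rfl
        rw [this, hx]
        rfl
      · filter_upwards [Lp.coeFn_zero SymMat 2 (volume.restrict P.Ω)] with x hx
        rw [hx]
        rfl
    have heq := hz.hessian_eq P.isOpen
    refine ⟨hz.memH2, P.Q.zero_mem, fun k _ => HasTrace.zero ?_ fun j => ?_⟩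
    · filter_upwards [Lp.coeFn_zero E2 2 (volume.restrict P.Ω)] with x hx
      have : H1.grad (0 : H1 P.Ω) = 0 := rfl
      simp only [normalD, this, hx, Pi.zero_apply, PiLp.zero_apply, mul_zero,
        Finset.sum_const_zero]
    · filter_upwards [Lp.coeFn_zero SymMat 2 (volume.restrict P.Ω)] with x hx
      have he : ∀ (i : Fin 2), (0 : SymMat).entry i j = 0 := fun _ => rfl
      simp only [gradNormalD, heq, hx, Pi.zero_apply, he, mul_zero, Finset.sum_const_zero]
  smul_mem' := by
    rintro c a ⟨ha, ha', ha''⟩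
    have hH := (ha.isHessian P.isOpen).smul c
    have heq := hH.hessian_eq P.isOpen
    refine ⟨hH.memH2, P.Q.smul_mem c ha', fun k hk => (ha'' k hk).smul_zero c ?_ fun j => ?_⟩
    · filter_upwards [Lp.coeFn_smul c (H1.grad a)] with x hx
      have : H1.grad (c • a) = c • H1.grad a := rfl
      simp only [normalD, this, hx, Pi.smul_apply, PiLp.smul_apply, smul_eq_mul, Finset.mul_sum]
      exact Finset.sum_congr rfl fun i _ => by ring
    · filter_upwards [Lp.coeFn_smul c (hessian a)] with x hx
      have he : ∀ (A : SymMat) (i : Fin 2), (c • A).entry i j = c * A.entry i j :=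
        fun _ _ => rfl
      simp only [gradNormalD, heq, hx, Pi.smul_apply, he, Finset.mul_sum]
      exact Finset.sum_congr rfl fun i _ => by ring

lemma W_le_Q : P.W ≤ P.Q := fun _ hv => hv.2.1

/-- The inclusion of `W` into `Q`. -/
def WtoQ : P.W →ₗ[ℝ] P.Q := Submodule.inclusion P.W_le_Q

/-- `div Div N = G`, where `div Div` is the adjoint of the operator `∇²` with domain `W`, regarded
as a densely defined operator in `Q`: the functional `G ∈ Q*` satisfies
`⟨G, v⟩ = ∫ ∇²v : N` for all `v ∈ W`. -/
def IsDivDiv (N : L2 P.Ω SymMat) (G : StrongDual ℝ P.Q) : Prop :=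
  ∀ v : P.W, ∫ x in P.Ω, inner ℝ (hessian (v : H1 P.Ω) x) (N x) = G (P.WtoQ v)

/-- `V = H(div Div, Ω; Q*)`, the domain of the operator `div Div`. -/
def V : Set (L2 P.Ω SymMat) := {N | ∃ G : StrongDual ℝ P.Q, P.IsDivDiv N G}

end Plate

/-- A material tensor: a symmetric positive definite linear map on symmetric matrices. -/
structure MaterialTensor where
  toLin : SymMat →ₗ[ℝ] SymMat
  symm : ∀ A B, inner ℝ (toLin A) B = inner ℝ A (toLin B)
  pos : ∀ A, A ≠ 0 → 0 < inner ℝ (toLin A) A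

namespace MaterialTensor

variable (C : MaterialTensor)

lemma injective : Function.Injective C.toLin := by
  rw [← LinearMap.ker_eq_bot, LinearMap.ker_eq_bot']
  intro A hA
  by_contra h
  have := C.pos A h
  simp [hA] at this

/-- The tensor as an invertible linear map. -/
def equiv : SymMat ≃L[ℝ] SymMat :=
  (LinearEquiv.ofInjectiveEndo C.toLin C.injective).toContinuousLinearEquiv

/-- `C N`, taken pointwise. -/
def apply {Ω : Set E2} (N : L2 Ω SymMat) : L2 Ω SymMat :=
  (C.equiv : SymMat →L[ℝ] SymMat).compLp N

/-- `C⁻¹ N`, taken pointwise. -/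
def applyInv {Ω : Set E2} (N : L2 Ω SymMat) : L2 Ω SymMat :=
  (C.equiv.symm : SymMat →L[ℝ] SymMat).compLp N

end MaterialTensor

namespace Plate

variable (P : Plate)

/-- `w ∈ W` solves the primal problem: `∫ C ∇²w : ∇²v = ⟨F, v⟩` for all `v ∈ W`. -/
def SolvesPrimal (C : MaterialTensor) (F : StrongDual ℝ P.Q) (w : P.W) : Prop :=
  ∀ v : P.W, ∫ x in P.Ω, inner ℝ (C.apply (hessian (w : H1 P.Ω)) x) (hessian (v : H1 P.Ω) x)
    = F (P.WtoQ v)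

/-- `(M, w) ∈ V × Q` solves the mixed problem:
`∫ C⁻¹ M : N + ⟨div Div N, w⟩ = 0` for all `N ∈ V` and
`⟨div Div M, v⟩ = -⟨F, v⟩` for all `v ∈ Q`. -/
def SolvesMixed (C : MaterialTensor) (F : StrongDual ℝ P.Q) (M : L2 P.Ω SymMat) (w : P.Q) :
    Prop :=
  M ∈ P.V ∧
  (∀ (N : L2 P.Ω SymMat) (G : StrongDual ℝ P.Q), P.IsDivDiv N G →
    (∫ x in P.Ω, inner ℝ (C.applyInv M x) (N x)) + G w = 0) ∧
  ∃ G : StrongDual ℝ P.Q, P.IsDivDiv M G ∧ ∀ v : P.Q, G v = - F v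

end Plate

end KirchhoffPlate

end

noncomputable section

namespace KirchhoffPlate

/-! ### Stability of weak derivatives and traces under limits -/

/-! Regard `∇²` with domain `W` as an operator from `Q` to `L²(Ω)_sym`; then `div Div` is by
definition its adjoint. The primal equation says that `M = -C∇²w` satisfies `div Div M = -F`. The
first mixed equation says that `-C⁻¹M` pairs with every `N ∈ V` as `⟨div Div N, w⟩`, that is, `w`
lies in the domain of the adjoint of `div Div` and is sent to `-C⁻¹M`.

From primal to mixed only the definition of `div Div` is needed, tested with `v = w`. The converse
must show that the adjoint of `div Div` is no larger than `∇²` on `W`. This is the biadjoint theorem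
for closed operators: a point outside a closed subspace of `Q × L²(Ω)_sym` is separated from it by a
continuous functional, and such a functional is precisely a pair `(G, N)` with `G = div Div N`
(`mem_of_forall_adjoint`). The argument works with graphs, and `G` ranges over all functionals
admissible for `N`, so density of `W` in `Q` plays no role.

The analytic content is therefore closedness of the graph (`isClosed_hessianGraph`). Weak
derivatives pass to `L²` limits because they are defined by testing. The clamped condition passes to
the limit because the normal derivative and its gradient depend linearly and continuously on `∇v`
and `∇²v`, and zero traces survive `H¹` limits by a diagonal argument (`HasTrace.of_tendsto`). No
regularity theory or solvability of either problem enters. -/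

lemma L2.neg_inner {X : Type} [NormedAddCommGroup X] [InnerProductSpace ℝ X] {Ω : Set E2}
    (f g : L2 Ω X) : inner ℝ (-f) g = -inner ℝ f g :=
  inner_neg_left f g

lemma L2.inner_comm {X : Type} [NormedAddCommGroup X] [InnerProductSpace ℝ X] {Ω : Set E2}
    (f g : L2 Ω X) : inner ℝ f g = inner ℝ g f :=
  real_inner_comm g f

/-- Testing a component of an `L²` function against a fixed `L²` function is continuous. -/
lemma continuous_integral_clm_mul {Ω : Set E2} {X : Type} [NormedAddCommGroup X]
    [NormedSpace ℝ X] (l : X →L[ℝ] ℝ) {ψ : E2 → ℝ} (hψ : MemLp ψ 2 (volume.restrict Ω)) :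
    Continuous fun p : L2 Ω X => ∫ x in Ω, l (p x) * ψ x := by
  have h : (fun p : L2 Ω X => ∫ x in Ω, l (p x) * ψ x) =
      fun p : L2 Ω X => inner ℝ (hψ.toLp ψ) (l.compLpL 2 (volume.restrict Ω) p) := by
    funext p
    rw [L2.inner_def]
    refine integral_congr_ae ?_
    filter_upwards [hψ.coeFn_toLp, l.coeFn_compLpL p] with x h1 h2
    rw [h1, h2]
    simp
  rw [h]
  exact continuous_const.inner (l.compLpL 2 (volume.restrict Ω)).continuous

lemma IsTestFunction.memLp {Ω : Set E2} {φ : E2 → ℝ} (hφ : IsTestFunction Ω φ) :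
    MemLp φ 2 (volume.restrict Ω) :=
  (hφ.1.continuous.memLp_of_hasCompactSupport hφ.2.1).restrict _

lemma H1.continuous_grad {Ω : Set E2} : Continuous (H1.grad (Ω := Ω)) :=
  (WithLp.continuous_snd 2 _ _).comp continuous_subtype_val

/-- The weak Hessian is a closed operator. -/
lemma isClosed_setOf_isHessian (Ω : Set E2) :
    IsClosed {z : H1 Ω × L2 Ω SymMat | IsHessian z.1 z.2} := by
  simp only [IsHessian, IsWeakPartial, ofPred_forall]
  -- For fixed `i`, `j`, `φ`, both sides of the integration by parts identity are continuous in the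
  -- pair `(v, H)`, so each condition is closed.
  refine isClosed_iInter fun i => isClosed_iInter fun j => isClosed_iInter fun φ =>
    isClosed_iInter fun hφ => isClosed_eq ?_ ?_
  · exact (continuous_integral_clm_mul (EuclideanSpace.proj (𝕜 := ℝ) i)
      (hφ.partialD j).memLp).comp (H1.continuous_grad.comp continuous_fst)
  · exact ((continuous_integral_clm_mul (entryL i j) hφ.memLp).comp continuous_snd).neg

/-- Turns convergence in the space `L²(Ω; X)` into the seminorm form in which `HasTrace` is phrased,
one scalar component at a time. -/
lemma tendsto_eLpNorm_clm_sub {Ω : Set E2} {X : Type} [NormedAddCommGroup X] [NormedSpace ℝ X]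
    (l : X →L[ℝ] ℝ) {p : ℕ → L2 Ω X} {q : L2 Ω X} (h : Tendsto p atTop (𝓝 q)) :
    Tendsto (fun k => eLpNorm (fun x => l (p k x) - l (q x)) 2 (volume.restrict Ω))
      atTop (𝓝 0) := by
  have h1 := ((l.compLpL 2 (volume.restrict Ω)).continuous.tendsto q).comp h
  rw [Lp.tendsto_Lp_iff_tendsto_eLpNorm'] at h1
  refine h1.congr fun k => eLpNorm_congr_ae ?_
  filter_upwards [l.coeFn_compLpL (p k), l.coeFn_compLpL q] with x h1 h2
  simp [h1, h2]

/-- Triangle inequality for `ψ n - u = (ψ n - v n) + (v n - u)`. -/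
lemma tendsto_eLpNorm_sub_of_approx {μ : Measure E2} {ψ v : ℕ → E2 → ℝ} {u : E2 → ℝ}
    (hψ : ∀ n, AEStronglyMeasurable (ψ n) μ) (hv : ∀ n, AEStronglyMeasurable (v n) μ)
    (hu : AEStronglyMeasurable u μ)
    (h : Tendsto (fun n => eLpNorm (fun x => ψ n x - v n x) 2 μ) atTop (𝓝 0))
    (h' : Tendsto (fun n => eLpNorm (fun x => v n x - u x) 2 μ) atTop (𝓝 0)) :
    Tendsto (fun n => eLpNorm (fun x => ψ n x - u x) 2 μ) atTop (𝓝 0) :=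
  tendsto_eLpNorm_add (f := fun n x => ψ n x - v n x) (a := fun _ => 0) (g := v) (b := u)
    (fun n => ((hψ n).sub (hv n)).sub aestronglyMeasurable_const) (fun n => (hv n).sub hu)
    (by simpa using h) h' (fun n x => by ring) (by filter_upwards with x; simp)

/-- The trace is a closed operator: it is stable under convergence in `H¹(Ω)`. -/
lemma HasTrace.of_tendsto {Ω S : Set E2} {u : ℕ → E2 → ℝ} {p : ℕ → E2 → E2} {u' : E2 → ℝ}
    {p' : E2 → E2} {g : E2 → ℝ} (h : ∀ n, HasTrace Ω S (u n) (p n) g)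
    (hu : ∀ n, AEStronglyMeasurable (u n) (volume.restrict Ω))
    (hp : ∀ n i, AEStronglyMeasurable (fun x => p n x i) (volume.restrict Ω))
    (hu' : AEStronglyMeasurable u' (volume.restrict Ω))
    (hp' : ∀ i, AEStronglyMeasurable (fun x => p' x i) (volume.restrict Ω))
    (tu : Tendsto (fun n => eLpNorm (fun x => u n x - u' x) 2 (volume.restrict Ω))
      atTop (𝓝 0))
    (tp : ∀ i : Fin 2, Tendsto
      (fun n => eLpNorm (fun x => p n x i - p' x i) 2 (volume.restrict Ω)) atTop (𝓝 0)) :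
    HasTrace Ω S u' p' g := by
  -- Diagonal choice: a single smooth function serves the `n`-th member within `1/n` in the
  -- interior, in the gradient and on the boundary. For `n = 0` the bound is `∞` and says nothing.
  -- The boundary datum `g` is common to all `n`, so continuity of a trace operator is not needed.
  have key : ∀ n : ℕ, ∃ ψ : E2 → ℝ, (ContDiff ℝ ∞ ψ ∧ HasCompactSupport ψ) ∧
      eLpNorm (fun x => ψ x - u n x) 2 (volume.restrict Ω) ≤ (n : ℝ≥0∞)⁻¹ ∧
      (∀ i : Fin 2, eLpNorm (fun x => partialD i ψ x - p n x i) 2 (volume.restrict Ω) ≤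
        (n : ℝ≥0∞)⁻¹) ∧
      eLpNorm (fun x => ψ x - g x) 2 ((μH[1] : Measure E2).restrict S) ≤ (n : ℝ≥0∞)⁻¹ := by
    intro n
    obtain ⟨φ, h1, h2, h3, h4⟩ := h n
    have hn : (0 : ℝ≥0∞) < (n : ℝ≥0∞)⁻¹ := ENNReal.inv_pos.mpr (ENNReal.natCast_ne_top n)
    have e := (((h2.eventually_le_const hn).and
      (eventually_all.mpr fun i => (h3 i).eventually_le_const hn)).and
      (h4.eventually_le_const hn)).exists
    obtain ⟨k, ⟨k1, k2⟩, k3⟩ := e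
    exact ⟨φ k, h1 k, k1, k2, k3⟩
  choose ψ c1 c2 c3 c4 using key
  have squeeze : ∀ {a : ℕ → ℝ≥0∞}, (∀ n, a n ≤ (n : ℝ≥0∞)⁻¹) → Tendsto a atTop (𝓝 0) :=
    fun ha => tendsto_of_tendsto_of_tendsto_of_le_of_le tendsto_const_nhds
      ENNReal.tendsto_inv_nat_nhds_zero (fun _ => zero_le) ha
  exact ⟨ψ, c1,
    tendsto_eLpNorm_sub_of_approx (fun n => (c1 n).1.continuous.aestronglyMeasurable) hu hu'
      (squeeze c2) tu,
    fun i => tendsto_eLpNorm_sub_of_approx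
      (fun n => (continuous_partialD (c1 n).1).aestronglyMeasurable) (fun n => hp n i) (hp' i)
      (squeeze fun n => c3 n i) (tp i),
    squeeze c4⟩

/-! ### The Hessian with domain `W` is a closed operator from `Q` to `L²(Ω)_sym` -/

namespace Plate

variable (P : Plate)

/-- `n · p` as a functional of the gradient `p`. -/
def normalFunctional (n : E2) : E2 →L[ℝ] ℝ :=
  ∑ i, n i • EuclideanSpace.proj (𝕜 := ℝ) i

/-- The `j`-th component of `A n` as a functional of the matrix `A`. -/
def mulNormalFunctional (n : E2) (j : Fin 2) : SymMat →L[ℝ] ℝ :=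
  ∑ i, n i • entryL i j

lemma normalFunctional_apply (n : E2) {Ω : Set E2} (v : H1 Ω) (x : E2) :
    normalFunctional n (H1.grad v x) = normalD n v x := by
  simp [normalFunctional, normalD]

lemma mulNormalFunctional_apply (n : E2) (j : Fin 2) {Ω : Set E2} (v : H1 Ω) (x : E2) :
    mulNormalFunctional n j (hessian v x) = gradNormalD n v x j := by
  simp only [mulNormalFunctional, gradNormalD, sum_apply,
    smul_apply, smul_eq_mul]
  rfl

lemma aestronglyMeasurable_normalD (n : E2) {Ω : Set E2} (v : H1 Ω) :
    AEStronglyMeasurable (normalD n v) (volume.restrict Ω) := by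
  simp only [← funext (normalFunctional_apply n v)]
  exact (normalFunctional n).continuous.comp_aestronglyMeasurable (Lp.aestronglyMeasurable _)

lemma aestronglyMeasurable_gradNormalD (n : E2) (j : Fin 2) {Ω : Set E2} (v : H1 Ω) :
    AEStronglyMeasurable (fun x => gradNormalD n v x j) (volume.restrict Ω) := by
  simp only [← mulNormalFunctional_apply n j v]
  exact (mulNormalFunctional n j).continuous.comp_aestronglyMeasurable
    (Lp.aestronglyMeasurable _)

/-- The graph of the operator `∇²` with domain `W`, as a subspace of `Q × L²(Ω)_sym`. -/
def hessianGraph : Submodule ℝ (P.Q × L2 P.Ω SymMat) where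
  carrier := {z | (z.1 : H1 P.Ω) ∈ P.W ∧ IsHessian (z.1 : H1 P.Ω) z.2}
  add_mem' := fun ha hb => ⟨P.W.add_mem ha.1 hb.1, ha.2.add hb.2⟩
  zero_mem' := by
    refine ⟨P.W.zero_mem, ?_⟩
    -- Scaling the pair `(0, ∇²0)` by zero shows that the zero matrix field is a Hessian of the zero
    -- function.
    have h := (P.W.zero_mem.1.isHessian P.isOpen).smul 0
    have e := zero_smul ℝ (hessian (0 : H1 P.Ω))
    have e' : (0 : ℝ) • hessian (0 : H1 P.Ω) = 0 := e
    rwa [zero_smul, e'] at h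
  smul_mem' := fun c _ ha => ⟨P.W.smul_mem c ha.1, ha.2.smul c⟩

/-- Convergence in the graph norm is convergence of `v`, `∇v` and `∇²v` in `L²`. This controls the
normal derivative in `H¹` on each clamped edge, because the normal is constant there. -/
lemma isClosed_hessianGraph : IsClosed (P.hessianGraph : Set (P.Q × L2 P.Ω SymMat)) := by
  refine IsSeqClosed.isClosed fun z y hz hy => ?_
  have t1 : Tendsto (fun n => ((z n).1 : H1 P.Ω)) atTop (𝓝 (y.1 : H1 P.Ω)) :=
    ((continuous_subtype_val.comp continuous_fst).tendsto y).comp hy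
  have t2 : Tendsto (fun n => (z n).2) atTop (𝓝 y.2) := (continuous_snd.tendsto y).comp hy
  have hH : IsHessian (y.1 : H1 P.Ω) y.2 :=
    (isClosed_setOf_isHessian P.Ω).mem_of_tendsto (t1.prodMk_nhds t2)
      (Eventually.of_forall fun n => (hz n).2)
  -- The condition `v = 0` on `Γ_c ∪ Γ_s` is already part of the limit belonging to `Q`; only the
  -- clamped condition remains.
  refine ⟨⟨hH.memH2, y.1.2, fun k hk => ?_⟩, hH⟩
  refine HasTrace.of_tendsto (fun n => (hz n).1.2.2 k hk)
    (fun n => aestronglyMeasurable_normalD _ _)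
    (fun n i => aestronglyMeasurable_gradNormalD _ i _)
    (aestronglyMeasurable_normalD _ _) (fun i => aestronglyMeasurable_gradNormalD _ i _)
    ?_ fun i => ?_
  · simp only [← normalFunctional_apply]
    exact tendsto_eLpNorm_clm_sub _ ((H1.continuous_grad.tendsto _).comp t1)
  -- By uniqueness of the weak Hessian, the second components of the graph points are the Hessians
  -- occurring in `gradNormalD`.
  · simp only [← mulNormalFunctional_apply, (hz _).2.hessian_eq P.isOpen,
      hH.hessian_eq P.isOpen]
    exact tendsto_eLpNorm_clm_sub _ t2

end Plate

/-! ### Closed operators and their biadjoints -/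

/-- A closed operator is recovered from its adjoint: an element of `A × B` that annihilates the
adjoint of a closed linear relation belongs to this relation. -/
lemma mem_of_forall_adjoint {A B : Type*} [NormedAddCommGroup A] [NormedSpace ℝ A]
    [NormedAddCommGroup B] [InnerProductSpace ℝ B] [CompleteSpace B] {S : Submodule ℝ (A × B)}
    (hS : IsClosed (S : Set (A × B))) {w : A} {H : B}
    (h : ∀ (N : B) (G : StrongDual ℝ A), (∀ z ∈ S, inner ℝ z.2 N = G z.1) →
      inner ℝ H N = G w) : (w, H) ∈ S := by
  by_contra hn
  obtain ⟨f, u, h1, h2⟩ := geometric_hahn_banach_closed_point S.convex hS hn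
  have hu : 0 < u := by simpa using h1 0 S.zero_mem
  -- A functional bounded above by `u` on a subspace vanishes there: otherwise a multiple of `a`
  -- would attain the value `u` itself.
  have hf : ∀ a ∈ S, f a = 0 := fun a ha => by
    by_contra h0
    have := h1 ((u / f a) • a) (S.smul_mem _ ha)
    rw [map_smul, smul_eq_mul, div_mul_cancel₀ _ h0] at this
    exact this.false
  -- The separating functional splits along the two factors. Riesz representation of the second
  -- part, with a minus sign, gives `f (v, K) = G v - ⟨K, N⟩`, so vanishing on `S` is exactly the
  -- adjoint relation between `N` and `G`.
  set G := f.comp (ContinuousLinearMap.inl ℝ A B) with hG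
  set N := (InnerProductSpace.toDual ℝ B).symm (-f.comp (ContinuousLinearMap.inr ℝ A B)) with hN
  have hsplit : ∀ (v : A) (K : B), f (v, K) = G v - inner ℝ K N := fun v K => by
    rw [real_inner_comm, hN, InnerProductSpace.toDual_symm_apply, neg_apply, sub_neg_eq_add]
    simp [hG, ← map_add]
  -- Separation gives `f (w, H) > u > 0`, whereas the hypothesis applied to `N` and `G` gives `f (w,
  -- H) = 0`.
  refine (hu.trans h2).ne' ?_
  rw [hsplit, h N G fun z hz => ?_, sub_self]
  have := hsplit z.1 z.2
  rw [Prod.mk.eta, hf z hz] at this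
  linarith

namespace Plate

variable (P : Plate)

/-- `∇²` with domain `W` contains the adjoint of `div Div`: if `∫ H : N = ⟨div Div N, w⟩` for all
`N ∈ V`, then `w ∈ W` and `∇²w = H`. -/
lemma mem_hessianGraph_of_adjoint {w : P.Q} {H : L2 P.Ω SymMat}
    (h : ∀ (N : L2 P.Ω SymMat) (G : StrongDual ℝ P.Q), P.IsDivDiv N G → inner ℝ H N = G w) :
    (w, H) ∈ P.hessianGraph := by
  -- Makes `L²(Ω)_sym` complete, as the Riesz representation requires.
  have : CompleteSpace SymMat := FiniteDimensional.complete ℝ SymMat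
  have key := @mem_of_forall_adjoint P.Q (L2 P.Ω SymMat) _ _ _ _ _ P.hessianGraph
    P.isClosed_hessianGraph w H
  -- Annihilating the graph, restricted to its points `(v, ∇²v)` with `v ∈ W`, is the definition of
  -- `div Div N = G`.
  refine key fun N G hNG => h N G fun v => ?_
  have h1 := hNG (P.WtoQ v, hessian (v : H1 P.Ω)) ⟨v.2, v.2.1.isHessian P.isOpen⟩
  rwa [L2.inner_def] at h1

end Plate

/-! ### Pointwise inversion of the material tensor -/

namespace MaterialTensor

variable (C : MaterialTensor) {Ω : Set E2}

lemma applyInv_neg_apply (N : L2 Ω SymMat) : C.applyInv (-C.apply N) = -N := by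
  refine Lp.ext ?_
  filter_upwards [(C.equiv.symm : SymMat →L[ℝ] SymMat).coeFn_compLp (-C.apply N),
    (C.equiv : SymMat →L[ℝ] SymMat).coeFn_compLp N, Lp.coeFn_neg (C.apply N),
    Lp.coeFn_neg N] with x h1 h2 h3 h4
  rw [applyInv, h1, h3, h4, Pi.neg_apply, Pi.neg_apply, apply, h2]
  simp

lemma apply_neg_applyInv (N : L2 Ω SymMat) : C.apply (-C.applyInv N) = -N := by
  refine Lp.ext ?_
  filter_upwards [(C.equiv : SymMat →L[ℝ] SymMat).coeFn_compLp (-C.applyInv N),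
    (C.equiv.symm : SymMat →L[ℝ] SymMat).coeFn_compLp N, Lp.coeFn_neg (C.applyInv N),
    Lp.coeFn_neg N] with x h1 h2 h3 h4
  rw [apply, h1, h3, h4, Pi.neg_apply, Pi.neg_apply, applyInv, h2]
  simp

end MaterialTensor

/-! ### Equivalence of the primal and mixed problems -/

namespace Plate

variable {P : Plate} {C : MaterialTensor} {F : StrongDual ℝ P.Q}

lemma isDivDiv_iff {N : L2 P.Ω SymMat} {G : StrongDual ℝ P.Q} :
    P.IsDivDiv N G ↔ ∀ v : P.W, inner ℝ (hessian (v : H1 P.Ω)) N = G (P.WtoQ v) := by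
  simp only [IsDivDiv, L2.inner_def]

lemma solvesPrimal_iff {w : P.W} : P.SolvesPrimal C F w ↔ ∀ v : P.W,
    inner ℝ (C.apply (hessian (w : H1 P.Ω))) (hessian (v : H1 P.Ω)) = F (P.WtoQ v) := by
  simp only [SolvesPrimal, L2.inner_def]

/-- The primal equation is the defining identity of `div Div` for `-C∇²w`, and `F` is bounded on all
of `Q`; this is what places `-C∇²w` in `V`. -/
lemma SolvesPrimal.isDivDiv {w : P.W} (hw : P.SolvesPrimal C F w) :
    P.IsDivDiv (-C.apply (hessian (w : H1 P.Ω))) (-F) :=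
  isDivDiv_iff.mpr fun v => by
    rw [L2.inner_comm, L2.neg_inner, solvesPrimal_iff.mp hw v]
    rfl

lemma SolvesPrimal.solvesMixed {w : P.W} (hw : P.SolvesPrimal C F w) :
    P.SolvesMixed C F (-C.apply (hessian (w : H1 P.Ω))) (P.WtoQ w) := by
  refine ⟨⟨-F, hw.isDivDiv⟩, fun N G hG => ?_, -F, hw.isDivDiv, fun _ => rfl⟩
  -- Since `C⁻¹M = -∇²w`, the first mixed equation is the definition of `div Div N` tested with `w`
  -- itself.
  rw [← L2.inner_def, C.applyInv_neg_apply, L2.neg_inner, isDivDiv_iff.mp hG w,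
    neg_add_cancel]

/-- The first mixed equation puts `(w, -C⁻¹M)` in the biadjoint of `∇²`, hence in its graph: this
yields both `w ∈ W` and `M = -C∇²w`. The second equation, tested only with `v ∈ W`, is then the
primal one. -/
lemma SolvesMixed.exists_solvesPrimal {M : L2 P.Ω SymMat} {w : P.Q}
    (h : P.SolvesMixed C F M w) :
    ∃ hw : (w : H1 P.Ω) ∈ P.W, P.SolvesPrimal C F ⟨w, hw⟩ := by
  obtain ⟨-, h1, G, hG, hGF⟩ := h
  obtain ⟨hw, hH⟩ := P.mem_hessianGraph_of_adjoint (w := w) (H := -C.applyInv M)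
    fun N G hN => by
      have := h1 N G hN
      rw [← L2.inner_def] at this
      rw [L2.neg_inner]
      linarith
  refine ⟨hw, solvesPrimal_iff.mpr fun v => ?_⟩
  have e : hessian ((⟨w, hw⟩ : P.W) : H1 P.Ω) = -C.applyInv M := hH.hessian_eq P.isOpen
  rw [e, C.apply_neg_applyInv, L2.neg_inner, L2.inner_comm, isDivDiv_iff.mp hG v, hGF,
    neg_neg]

end Plate

end KirchhoffPlate

end

theorem mainTheorem3 (P : KirchhoffPlate.Plate) (C : KirchhoffPlate.MaterialTensor)
    (F : StrongDual ℝ P.Q) :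
    (∀ w : P.W, P.SolvesPrimal C F w →
      -C.apply (KirchhoffPlate.hessian (w : KirchhoffPlate.H1 P.Ω)) ∈ P.V ∧
      P.SolvesMixed C F (-C.apply (KirchhoffPlate.hessian (w : KirchhoffPlate.H1 P.Ω)))
        (P.WtoQ w)) ∧
    (∀ (M : KirchhoffPlate.L2 P.Ω KirchhoffPlate.SymMat) (w : P.Q), P.SolvesMixed C F M w →
      ∃ hw : (w : KirchhoffPlate.H1 P.Ω) ∈ P.W, P.SolvesPrimal C F ⟨w, hw⟩) :=
  ⟨fun _ hw => ⟨⟨-F, hw.isDivDiv⟩, hw.solvesMixed⟩, fun _ _ h => h.exists_solvesPrimal⟩
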